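/- Let $M$ be a smooth four-manifold with a smooth pseudo-Riemannian metric $g$ of arbitrary signature (in particular, a Riemannian or a Lorentzian one). Let $r+s=6$, let $\mathbb{R}^{r,s}$ be $\mathbb{R}^6$ with the flat metric $\eta$ having $r$ plus and $s$ minus signs, and suppose that $(M,g)$ has a local isometric embedding into $\mathbb{R}^{r,s}$, that is, a smooth embedding $\iota:U\to\mathbb{R}^{r,s}$ of an open set $U\subseteq M$ with $\iota^*\eta=g$ on $U$. Let $q\in U$ and fix an orientation of $T_qM$. Let $\epsilon_{abcd}$ be the corresponding volume form of $g$ at $q$ (equal to $\sqrt{|\det(g_{ij})|}$ on a positively oriented basis, where $g_{ij}$ is the Gram matrix of that basis), and let ${R_{abc}}^d$ be the Riemann tensor of $g$, with the sign convention $(\nabla_a\nabla_b-\nabla_b\nabla_a)V^d={R_{abc}}^dV^c$. Let $P$ be the endomorphism of the space of two-forms on $T_qM$ given by $$(P\alpha)_{ab}={P_{ab}}^{cd}\alpha_{cd},\qquad {P_{ab}}^{cd}=-\tfrac12\,\epsilon_{abij}R^{ijcd},$$ with indices raised by $g$. Then $$\operatorname{tr}(P^3)={P^{ab}}_{cd}{P^{cd}}_{ef}{P^{ef}}_{ab}=0,\qquad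 \operatorname{tr}(P^5)=0,$$ and, more generally, $\operatorname{tr}(P^n)=0$ for every odd $n\ge 1$. -/

import Mathlib

open scoped Manifold ContDiff Topology

noncomputable section

namespace FourManifold

/-- The model space of a four-manifold. -/
abbrev E4 : Type := EuclideanSpace ℝ (Fin 4)

/-- A smooth pseudo-Riemannian metric, of arbitrary signature, on a smooth four-manifold `M`:
a smooth field of nondegenerate symmetric bilinear forms on the tangent spaces. -/
structure PseudoRiemannianMetric (M : Type*) [TopologicalSpace M] [ChartedSpace E4 M]
    [IsManifold 𝓘(ℝ, E4) ∞ M] where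
  /-- The bilinear form on the tangent space at `q`. -/
  inner (q : M) : TangentSpace 𝓘(ℝ, E4) q →L[ℝ] TangentSpace 𝓘(ℝ, E4) q →L[ℝ] ℝ
  symm (q : M) (v w : TangentSpace 𝓘(ℝ, E4) q) : inner q v w = inner q w v
  nondegenerate (q : M) (v : TangentSpace 𝓘(ℝ, E4) q) (hv : ∀ w, inner q v w = 0) : v = 0
  contMDiff : ContMDiff 𝓘(ℝ, E4) (𝓘(ℝ, E4).prod 𝓘(ℝ, E4 →L[ℝ] E4 →L[ℝ] ℝ)) ∞
    (fun q ↦ Bundle.TotalSpace.mk' (E4 →L[ℝ] E4 →L[ℝ] ℝ)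
      (E := fun q : M ↦ TangentSpace 𝓘(ℝ, E4) q →L[ℝ] TangentSpace 𝓘(ℝ, E4) q →L[ℝ] ℝ)
      q (inner q))

/-- The vector space underlying the pseudo-Euclidean space `ℝ^{r,s}`. -/
abbrev PseudoEuclidean (r s : ℕ) : Type := EuclideanSpace ℝ (Fin r ⊕ Fin s)

/-- The flat metric `η` of signature `(r, s)`: `r` plus signs and `s` minus signs. -/
def flatMetric (r s : ℕ) (u v : PseudoEuclidean r s) : ℝ :=
  ∑ i : Fin r, u (Sum.inl i) * v (Sum.inl i) - ∑ j : Fin s, u (Sum.inr j) * v (Sum.inr j)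

lemma finrank_tangentSpace {M : Type*} [TopologicalSpace M] [ChartedSpace E4 M]
    (q : M) :
    Fintype.card (Fin 4) = Module.finrank ℝ (TangentSpace 𝓘(ℝ, E4) q) :=
  (finrank_euclideanSpace (𝕜 := ℝ) (ι := Fin 4)).symm

instance finiteDimensional_tangentSpace {M : Type*} [TopologicalSpace M] [ChartedSpace E4 M]
    (q : M) : FiniteDimensional ℝ (TangentSpace 𝓘(ℝ, E4) q) :=
  inferInstanceAs (FiniteDimensional ℝ E4)

section Definitions

variable {M : Type*} [TopologicalSpace M] [ChartedSpace E4 M] [IsManifold 𝓘(ℝ, E4) ∞ M]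

/-- `ι` restricts to an isometric embedding of the open set `U ⊆ M` into `ℝ^{r,s}`: it is smooth
on `U`, a homeomorphism of `U` onto its image, has injective differential at the points of `U`,
and `ι^* η = g` on `U`. (The values of `ι` outside `U` play no role.) -/
structure IsIsometricEmbeddingOn (g : PseudoRiemannianMetric M) (r s : ℕ)
    (U : Set M) (ι : M → PseudoEuclidean r s) : Prop where
  isOpen : IsOpen U
  contMDiffOn : ContMDiffOn 𝓘(ℝ, E4) 𝓘(ℝ, PseudoEuclidean r s) ∞ ι U
  isEmbedding : Topology.IsEmbedding (U.domRestrict ι)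
  injective_mfderiv : ∀ q ∈ U,
    Function.Injective (mfderiv 𝓘(ℝ, E4) 𝓘(ℝ, PseudoEuclidean r s) ι q)
  isometric : ∀ q ∈ U, ∀ v w : TangentSpace 𝓘(ℝ, E4) q,
    flatMetric r s (mfderiv 𝓘(ℝ, E4) 𝓘(ℝ, PseudoEuclidean r s) ι q v)
      (mfderiv 𝓘(ℝ, E4) 𝓘(ℝ, PseudoEuclidean r s) ι q w) = g.inner q v w

/-- The coordinate vector `∂_i` at `q` of a chart `φ` around `q`: the tangent vector which the
differential of `φ` at `q` (invertible for a chart of the smooth structure) sends to the `i`-th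
standard vector. -/
def coordVector (φ : OpenPartialHomeomorph M E4) (q : M) (i : Fin 4) :
    TangentSpace 𝓘(ℝ, E4) q :=
  (mfderiv 𝓘(ℝ, E4) 𝓘(ℝ, E4) φ q).inverse (EuclideanSpace.single i (1 : ℝ) : E4)

/-- The components `g_{ij}` of the metric in the chart `φ`, as functions of the coordinates. -/
def metricMatrix (g : PseudoRiemannianMetric M) (φ : OpenPartialHomeomorph M E4) (x : E4) :
    Matrix (Fin 4) (Fin 4) ℝ :=
  Matrix.of fun i j ↦
    g.inner (φ.symm x) (coordVector φ (φ.symm x) i) (coordVector φ (φ.symm x) j)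

/-- The partial derivative `∂_a f` at `x`. -/
def partialDeriv (a : Fin 4) (f : E4 → ℝ) (x : E4) : ℝ :=
  fderiv ℝ f x (EuclideanSpace.single a 1)

/-- The Christoffel symbols of the Levi-Civita connection,
`Γ^d_{bc} = ½ g^{de} (∂_b g_{ec} + ∂_c g_{eb} - ∂_e g_{bc})`. -/
def christoffel (g : PseudoRiemannianMetric M) (φ : OpenPartialHomeomorph M E4)
    (d b c : Fin 4) (x : E4) : ℝ :=
  (1 / 2) * ∑ e, (metricMatrix g φ x)⁻¹ d e *
    (partialDeriv b (fun y ↦ metricMatrix g φ y e c) x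
      + partialDeriv c (fun y ↦ metricMatrix g φ y e b) x
      - partialDeriv e (fun y ↦ metricMatrix g φ y b c) x)

/-- The components `R_{abc}{}^d` of the Riemann tensor, with the sign convention
`(∇_a ∇_b - ∇_b ∇_a) V^d = R_{abc}{}^d V^c`, that is
`R_{abc}{}^d = ∂_a Γ^d_{bc} - ∂_b Γ^d_{ac} + Γ^d_{ae} Γ^e_{bc} - Γ^d_{be} Γ^e_{ac}`. -/
def riemann (g : PseudoRiemannianMetric M) (φ : OpenPartialHomeomorph M E4)
    (a b c d : Fin 4) (x : E4) : ℝ :=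
  partialDeriv a (christoffel g φ d b c) x - partialDeriv b (christoffel g φ d a c) x
    + ∑ e, (christoffel g φ d a e x * christoffel g φ e b c x
      - christoffel g φ d b e x * christoffel g φ e a c x)

/-- The components `R^{pqcd} = g^{pa} g^{qb} g^{ce} R_{abe}{}^d`. -/
def riemannUp (g : PseudoRiemannianMetric M) (φ : OpenPartialHomeomorph M E4)
    (p q c d : Fin 4) (x : E4) : ℝ :=
  ∑ a, ∑ b, ∑ e, (metricMatrix g φ x)⁻¹ p a * (metricMatrix g φ x)⁻¹ q b *
    (metricMatrix g φ x)⁻¹ c e * riemann g φ a b e d x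

/-- The Gram matrix of a quadruple of tangent vectors. -/
def gram (g : PseudoRiemannianMetric M) (q : M) (v : Fin 4 → TangentSpace 𝓘(ℝ, E4) q) :
    Matrix (Fin 4) (Fin 4) ℝ :=
  Matrix.of fun i j ↦ g.inner q (v i) (v j)

/-- The volume form `ε` at `q` of `g` for the orientation `o` of the tangent space: it is
`√|det (g(b_i, b_j))| b¹ ∧ b² ∧ b³ ∧ b⁴` for a positively oriented basis `b`; see
`volumeForm_eq` for the independence of `b`. -/
def volumeForm (g : PseudoRiemannianMetric M) (q : M)
    (o : Orientation ℝ (TangentSpace 𝓘(ℝ, E4) q) (Fin 4)) :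
    TangentSpace 𝓘(ℝ, E4) q [⋀^Fin 4]→ₗ[ℝ] ℝ :=
  √|(gram g q (o.someBasis (finrank_tangentSpace q))).det| •
    (o.someBasis (finrank_tangentSpace q)).det

lemma volumeForm_eq (g : PseudoRiemannianMetric M) (q : M)
    (o : Orientation ℝ (TangentSpace 𝓘(ℝ, E4) q) (Fin 4))
    (b : Module.Basis (Fin 4) ℝ (TangentSpace 𝓘(ℝ, E4) q)) (hb : b.orientation = o) :
    volumeForm g q o = √|(gram g q b).det| • b.det := by
  set b₀ := o.someBasis (finrank_tangentSpace q) with hb₀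
  have hpos : 0 < b₀.det b := by
    rw [← Module.Basis.orientation_eq_iff_det_pos, hb, hb₀, Orientation.someBasis_orientation]
  have hgram : gram g q b = (b₀.toMatrix b).transpose * gram g q b₀ * b₀.toMatrix b := by
    ext i j
    have h (k : Fin 4) : b k = ∑ l, b₀.toMatrix b l k • b₀ l :=
      (b₀.sum_toMatrix_smul_self b k).symm
    simp only [gram, Matrix.of_apply, Matrix.mul_apply, Matrix.transpose_apply]
    conv_lhs => rw [h i, h j]
    simp only [map_sum, map_smul, FunLike.coe_sum, Finset.sum_apply,
      FunLike.coe_smul, Pi.smul_apply,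
      smul_eq_mul, Finset.mul_sum, Finset.sum_mul]
    refine Finset.sum_congr rfl fun l _ ↦ Finset.sum_congr rfl fun k _ ↦ by ring
  have hdet : (gram g q b).det = (b₀.det b) ^ 2 * (gram g q b₀).det := by
    rw [hgram, Matrix.det_mul, Matrix.det_mul, Matrix.det_transpose, Module.Basis.det_apply]
    ring
  have hb' : b₀.det = b₀.det b • b.det := b₀.det.eq_smul_basis_det b
  rw [hdet, abs_mul, abs_of_nonneg (sq_nonneg _), Real.sqrt_mul (sq_nonneg _),
    Real.sqrt_sq hpos.le, mul_comm, mul_smul, ← hb']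
  rfl

/-- The curvature endomorphism of the two-forms on the tangent space at `q`,
`(P α)_{ab} = P_{ab}{}^{cd} α_{cd}` with `P_{ab}{}^{cd} = -½ ε_{abij} R^{ijcd}`. The components are
those of the coordinate frame of a chart `φ` around `q`. In the code, the two-form
`ε(∂_i, ∂_j, ·, ·)` has the components `ε_{ijab} = ε_{abij}`. -/
def curvatureEndomorphism (g : PseudoRiemannianMetric M) (q : M)
    (o : Orientation ℝ (TangentSpace 𝓘(ℝ, E4) q) (Fin 4)) (φ : OpenPartialHomeomorph M E4) :
    Module.End ℝ (TangentSpace 𝓘(ℝ, E4) q [⋀^Fin 2]→ₗ[ℝ] ℝ) where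
  toFun α := (-(1 / 2) : ℝ) • ∑ i, ∑ j, ∑ c, ∑ d,
    (riemannUp g φ i j c d (φ q) * α ![coordVector φ q c, coordVector φ q d]) •
      ((volumeForm g q o).curryLeft (coordVector φ q i)).curryLeft (coordVector φ q j)
  map_add' α₁ α₂ := by
    simp only [AlternatingMap.add_apply, mul_add, add_smul, Finset.sum_add_distrib, smul_add]
  map_smul' t α := by
    simp only [AlternatingMap.smul_apply, smul_eq_mul, RingHom.id_apply, Finset.smul_sum,
      smul_smul]
    refine Finset.sum_congr rfl fun i _ ↦ Finset.sum_congr rfl fun j _ ↦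
      Finset.sum_congr rfl fun c _ ↦ Finset.sum_congr rfl fun d _ ↦ ?_
    congr 1
    ring

end Definitions

end FourManifold

end

/-! By the Gauss equation the curvature of a submanifold of flat space is quadratic in the second
derivatives of the embedding, paired by the normal part of `η`. That normal part is a symmetric form
on a six-dimensional space whose radical contains the four-dimensional tangent space, so it is a
combination of two squares of linear forms (`exists_eq_sum_two_squares`). Hence `R` is a combination
of two terms `K ∧ K` with `K` symmetric (`exists_riemannUp_eq`), and `P = e₀ C₀ + e₁ C₁`, where each
`C` is the second exterior power of `K` followed by contraction with `ε`
(`curvatureEndomorphism_eq_sum`).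

Each `C` squares to a scalar, a multiple of `det K`, by Laplace expansion
(`compoundEndomorphism_mul_self`). Each `C` is trace-free, because `K` is symmetric and `ε` is skew
(`trace_compoundEndomorphism`).

The rest is algebra: if `A` and `B` have scalar squares, then `(A + B)²` commutes with both, and the
traces of `(A + B)²ᵏ A` and `(A + B)²ᵏ B` vanish by a joint induction on `k`
(`trace_sq_add_pow_mul_eq_zero`). -/

noncomputable section

namespace FourManifold

/-! ### Odd powers of a sum of two operators with scalar squares. -/

section TraceOddPower

variable {K V : Type*} [CommRing K] [AddCommGroup V] [Module K V]

/-- With `D = (A + B)² = a + b + AB + BA`, the product `D A` equals `(a + b) A + ABA + a B`. Since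
`D` commutes with `A`, cyclicity turns the trace of `Dᵏ ABA` into `a` times that of `Dᵏ B`. The
induction therefore needs both statements at once. -/
lemma trace_sq_add_pow_mul_eq_zero {A B : Module.End K V} {a b : K}
    (hA : A * A = a • 1) (hB : B * B = b • 1)
    (tA : LinearMap.trace K V A = 0) (tB : LinearMap.trace K V B = 0) (k : ℕ) :
    LinearMap.trace K V (((A + B) * (A + B)) ^ k * A) = 0 ∧
      LinearMap.trace K V (((A + B) * (A + B)) ^ k * B) = 0 := by
  set D := (A + B) * (A + B) with hD
  have hD' : D = (a + b) • 1 + (A * B + B * A) := by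
    rw [hD, add_smul, ← hA, ← hB]; noncomm_ring
  have hDA (k : ℕ) : Commute (D ^ k) A := by
    refine Commute.pow_left ?_ k
    rw [hD', commute_iff_eq, add_mul, mul_add, smul_mul_assoc, mul_smul_comm, one_mul, mul_one]
    congr 1
    rw [add_mul, mul_add, mul_assoc B A A, ← mul_assoc A A B, hA]
    simp [mul_assoc, add_comm]
  have hDB (k : ℕ) : Commute (D ^ k) B := by
    refine Commute.pow_left ?_ k
    rw [hD', commute_iff_eq, add_mul, mul_add, smul_mul_assoc, mul_smul_comm, one_mul, mul_one]
    congr 1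
    rw [add_mul, mul_add, mul_assoc A B B, ← mul_assoc B B A, hB]
    simp [mul_assoc, add_comm]
  induction k with
  | zero => simp [tA, tB]
  | succ k ih =>
    obtain ⟨ihA, ihB⟩ := ih
    have h₁ : LinearMap.trace K V (D ^ k * (A * B * A)) = a * LinearMap.trace K V (D ^ k * B) := by
      rw [← mul_assoc, LinearMap.trace_mul_comm, ← mul_assoc, ← (hDA k).eq, mul_assoc,
        ← mul_assoc A, hA]
      simp
    have h₂ : LinearMap.trace K V (D ^ k * (B * A * B)) = b * LinearMap.trace K V (D ^ k * A) := by
      rw [← mul_assoc, LinearMap.trace_mul_comm, ← mul_assoc, ← (hDB k).eq, mul_assoc,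
        ← mul_assoc B, hB]
      simp
    constructor
    · have : D ^ (k + 1) * A
          = (a + b) • (D ^ k * A) + D ^ k * (A * B * A) + a • (D ^ k * B) := by
        have : D * A = (a + b) • A + A * B * A + a • B := by
          rw [hD', add_mul, add_mul, mul_assoc B, hA]; simp [add_assoc]
        rw [pow_succ, mul_assoc, this]; simp [mul_add]
      simp [this, h₁, ihA, ihB]
    · have : D ^ (k + 1) * B
          = (a + b) • (D ^ k * B) + D ^ k * (B * A * B) + b • (D ^ k * A) := by
        have : D * B = (a + b) • B + B * A * B + b • A := by
          rw [hD', add_mul, add_mul, mul_assoc A, hB]; simp; abel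
        rw [pow_succ, mul_assoc, this]; simp [mul_add]
      simp [this, h₂, ihA, ihB]

/-- The odd powers of a sum of two trace-free endomorphisms with scalar squares are
trace-free. -/
lemma trace_add_pow_eq_zero_of_odd {A B : Module.End K V} {a b : K}
    (hA : A * A = a • 1) (hB : B * B = b • 1)
    (tA : LinearMap.trace K V A = 0) (tB : LinearMap.trace K V B = 0) {n : ℕ} (hn : Odd n) :
    LinearMap.trace K V ((A + B) ^ n) = 0 := by
  obtain ⟨k, rfl⟩ := hn
  obtain ⟨h₁, h₂⟩ := trace_sq_add_pow_mul_eq_zero hA hB tA tB k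
  rw [pow_succ, pow_mul, pow_two, mul_add, map_add, h₁, h₂, add_zero]

end TraceOddPower

/-! ### Symmetric forms with a large radical. -/

section SymmetricForms

variable {W : Type*} [AddCommGroup W] [Module ℝ W] [FiniteDimensional ℝ W]

/-- A symmetric bilinear form whose radical has codimension at most two is a combination of two
squares of linear forms. -/
lemma exists_eq_sum_two_squares (B : LinearMap.BilinForm ℝ W) (hB : B.IsSymm)
    {n : ℕ} (t : Fin n → W) (ht : LinearIndependent ℝ t) (hn : Module.finrank ℝ W = n + 2)
    (htB : ∀ i w, B (t i) w = 0) :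
    ∃ (e : Fin 2 → ℝ) (l : Fin 2 → W →ₗ[ℝ] ℝ), ∀ u v, B u v = ∑ i, e i * (l i u * l i v) := by
  set T := Submodule.span ℝ (Set.range t) with hT
  obtain ⟨C, hC⟩ := T.exists_isCompl
  have hTB : ∀ u ∈ T, ∀ w, B u w = 0 := by
    intro u hu w
    induction hu using Submodule.span_induction with
    | mem x hx => obtain ⟨i, rfl⟩ := hx; exact htB i w
    | zero => simp
    | add x y _ _ hx hy => simp [hx, hy]
    | smul c x _ hx => simp [hx]
  have hfC : Module.finrank ℝ C = 2 := by
    have h₁ := Submodule.finrank_add_eq_of_isCompl hC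
    have h₂ : Module.finrank ℝ T = n := by simpa using finrank_span_eq_card ht
    omega
  -- The complement `C` of `T` is a plane, and `B` factors through the projection to it along `T`.
  -- An orthogonal basis exists even if the restriction is degenerate; the coefficients `e i` below
  -- are its diagonal values and may vanish.
  obtain ⟨v, hv⟩ := LinearMap.BilinForm.exists_orthogonal_basis (B := B.restrict C)
    ⟨fun x y ↦ hB.eq x y⟩
  set v' := v.reindex (finCongr hfC)
  let p : W →ₗ[ℝ] C := C.projectionOnto T hC.symm
  have hp (u w : W) : B u w = B (p u) (p w) := by
    have hq (u : W) : ∃ x ∈ T, u = x + p u := by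
      exact ⟨u - p u, Submodule.sub_projection_mem hC.symm u, by simp⟩
    obtain ⟨x, hx, hxu⟩ := hq u
    obtain ⟨y, hy, hyw⟩ := hq w
    have h₁ : B u w = B (p u) w := by
      conv_lhs => rw [hxu]
      simp [hTB x hx]
    have h₂ : B (p u) w = B (p u) (p w) := by
      conv_lhs => rw [hyw]
      rw [map_add, show B (p u) y = B y (p u) from hB.eq _ _, hTB y hy, zero_add]
    rw [h₁, h₂]
  refine ⟨fun i ↦ B (v' i) (v' i), fun i ↦ (v'.coord i) ∘ₗ p, fun u w ↦ ?_⟩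
  rw [hp]
  have hsum (x : C) : (x : W) = ∑ i, v'.coord i x • (v' i : W) := by
    conv_lhs => rw [← v'.sum_repr x]
    simp only [Submodule.coe_sum, Submodule.coe_smul, Module.Basis.coord_apply]
  have horth (i j : Fin 2) (hij : i ≠ j) : B (v' i) (v' j) = 0 := by
    have := hv (i := (finCongr hfC).symm i) (j := (finCongr hfC).symm j) (by simpa using hij)
    simpa [v'] using this
  rw [hsum (p u), hsum (p w)]
  simp [Fin.sum_univ_two, horth]
  ring

end SymmetricForms

/-! ### Skew 4×4 matrices and their duals. -/

section Dual

/-- Finiteness makes `LinearMap.trace` on two-forms the genuine trace and not its default value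
zero. -/
instance finite_alternatingMap {V : Type*} [AddCommGroup V] [Module ℝ V]
    [FiniteDimensional ℝ V] (n : ℕ) : Module.Finite ℝ (V [⋀^Fin n]→ₗ[ℝ] ℝ) :=
  Module.Finite.of_injective
    (AlternatingMap.toMultilinearMapLM (R := ℝ) (S := ℝ) (M := V) (N := ℝ) (ι := Fin n))
    AlternatingMap.coe_multilinearMap_injective

/-- The skew matrix with the given entries above the diagonal. -/
def skewMatrix (x01 x02 x03 x12 x13 x23 : ℝ) : Matrix (Fin 4) (Fin 4) ℝ :=
  !![0, x01, x02, x03; -x01, 0, x12, x13; -x02, -x12, 0, x23; -x03, -x13, -x23, 0]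

lemma eq_skewMatrix {N : Matrix (Fin 4) (Fin 4) ℝ} (hN : N.transpose = -N) :
    N = skewMatrix (N 0 1) (N 0 2) (N 0 3) (N 1 2) (N 1 3) (N 2 3) := by
  have n (i j) : N i j = - N j i := congrFun (congrFun hN j) i
  have n0 (i) : N i i = 0 := by linarith [n i i]
  ext a b
  fin_cases a <;> fin_cases b <;>
    simp [skewMatrix, n0, n 1 0, n 2 0, n 3 0, n 2 1, n 3 1, n 3 2]

/-- The Hodge dual of a skew matrix, `½ ε_{abij} N_{ij}`. -/
def dualMatrix (N : Matrix (Fin 4) (Fin 4) ℝ) : Matrix (Fin 4) (Fin 4) ℝ :=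
  skewMatrix (N 2 3) (-N 1 3) (N 1 2) (N 0 3) (-N 0 2) (N 0 1)

lemma dualMatrix_skewMatrix (x01 x02 x03 x12 x13 x23 : ℝ) :
    dualMatrix (skewMatrix x01 x02 x03 x12 x13 x23)
      = skewMatrix x23 (-x13) x12 x03 (-x02) x01 := rfl

/-- The symmetric matrix with the given entries on and above the diagonal. -/
def symmMatrix (k00 k01 k02 k03 k11 k12 k13 k22 k23 k33 : ℝ) : Matrix (Fin 4) (Fin 4) ℝ :=
  !![k00, k01, k02, k03; k01, k11, k12, k13; k02, k12, k22, k23; k03, k13, k23, k33]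

lemma eq_symmMatrix {K : Matrix (Fin 4) (Fin 4) ℝ} (hK : K.IsSymm) :
    K = symmMatrix (K 0 0) (K 0 1) (K 0 2) (K 0 3) (K 1 1) (K 1 2) (K 1 3) (K 2 2) (K 2 3)
      (K 3 3) := by
  have k (i j) : K i j = K j i := hK.apply j i
  ext a b
  fin_cases a <;> fin_cases b <;>
    simp [symmMatrix, k 1 0, k 2 0, k 3 0, k 2 1, k 3 1, k 3 2]

lemma det_symmMatrix (k00 k01 k02 k03 k11 k12 k13 k22 k23 k33 : ℝ) :
    (symmMatrix k00 k01 k02 k03 k11 k12 k13 k22 k23 k33).det =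
      k00 * (k11 * (k22 * k33 - k23 ^ 2) - k12 * (k12 * k33 - k23 * k13)
        + k13 * (k12 * k23 - k22 * k13))
      - k01 * (k01 * (k22 * k33 - k23 ^ 2) - k12 * (k02 * k33 - k23 * k03)
        + k13 * (k02 * k23 - k22 * k03))
      + k02 * (k01 * (k12 * k33 - k13 * k23) - k11 * (k02 * k33 - k23 * k03)
        + k13 * (k02 * k13 - k12 * k03))
      - k03 * (k01 * (k12 * k23 - k13 * k22) - k11 * (k02 * k23 - k22 * k03)
        + k12 * (k02 * k13 - k12 * k03)) := by
  rw [Matrix.det_succ_row_zero]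
  simp [Fin.sum_univ_four, Matrix.det_fin_three, symmMatrix, Fin.succAbove]
  ring

-- The coefficients are the 2×2 minors of `K`: this is the second compound matrix acting on the six
-- independent entries.
set_option maxHeartbeats 2000000 in
lemma symmMatrix_mul_skewMatrix_mul (k00 k01 k02 k03 k11 k12 k13 k22 k23 k33 : ℝ)
    (x01 x02 x03 x12 x13 x23 : ℝ) :
    symmMatrix k00 k01 k02 k03 k11 k12 k13 k22 k23 k33 * skewMatrix x01 x02 x03 x12 x13 x23
      * symmMatrix k00 k01 k02 k03 k11 k12 k13 k22 k23 k33 = skewMatrix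
      ((k00 * k11 - k01 * k01) * x01
        + (k00 * k12 - k02 * k01) * x02
        + (k00 * k13 - k03 * k01) * x03
        + (k01 * k12 - k02 * k11) * x12
        + (k01 * k13 - k03 * k11) * x13
        + (k02 * k13 - k03 * k12) * x23)
      ((k00 * k12 - k01 * k02) * x01
        + (k00 * k22 - k02 * k02) * x02
        + (k00 * k23 - k03 * k02) * x03
        + (k01 * k22 - k02 * k12) * x12
        + (k01 * k23 - k03 * k12) * x13
        + (k02 * k23 - k03 * k22) * x23)
      ((k00 * k13 - k01 * k03) * x01
        + (k00 * k23 - k02 * k03) * x02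
        + (k00 * k33 - k03 * k03) * x03
        + (k01 * k23 - k02 * k13) * x12
        + (k01 * k33 - k03 * k13) * x13
        + (k02 * k33 - k03 * k23) * x23)
      ((k01 * k12 - k11 * k02) * x01
        + (k01 * k22 - k12 * k02) * x02
        + (k01 * k23 - k13 * k02) * x03
        + (k11 * k22 - k12 * k12) * x12
        + (k11 * k23 - k13 * k12) * x13
        + (k12 * k23 - k13 * k22) * x23)
      ((k01 * k13 - k11 * k03) * x01
        + (k01 * k23 - k12 * k03) * x02
        + (k01 * k33 - k13 * k03) * x03
        + (k11 * k23 - k12 * k13) * x12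
        + (k11 * k33 - k13 * k13) * x13
        + (k12 * k33 - k13 * k23) * x23)
      ((k02 * k13 - k12 * k03) * x01
        + (k02 * k23 - k22 * k03) * x02
        + (k02 * k33 - k23 * k03) * x03
        + (k12 * k23 - k22 * k13) * x12
        + (k12 * k33 - k23 * k13) * x13
        + (k22 * k33 - k23 * k23) * x23) := by
  ext a b
  fin_cases a <;> fin_cases b <;> simp [symmMatrix, skewMatrix] <;> ring

lemma smul_skewMatrix (c x01 x02 x03 x12 x13 x23 : ℝ) :
    c • skewMatrix x01 x02 x03 x12 x13 x23 =
      skewMatrix (c * x01) (c * x02) (c * x03) (c * x12) (c * x13) (c * x23) := by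
  simp [skewMatrix]

/-- The square of the adjugate of a symmetric matrix acting on skew matrices. -/
lemma dualMatrix_mul_dualMatrix_mul {K N : Matrix (Fin 4) (Fin 4) ℝ} (hK : K.IsSymm)
    (hN : N.transpose = -N) :
    dualMatrix (K * dualMatrix (K * N * K) * K) = K.det • N := by
  -- In the six independent entries, the identity is the Laplace expansion of `det K` along pairs of
  -- rows: products of complementary 2×2 minors sum to `det K` or to zero.
  rw [eq_symmMatrix hK, eq_skewMatrix hN, symmMatrix_mul_skewMatrix_mul, dualMatrix_skewMatrix,
    symmMatrix_mul_skewMatrix_mul, dualMatrix_skewMatrix, det_symmMatrix, smul_skewMatrix]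
  congr 1 <;> ring

variable {V : Type*} [AddCommGroup V] [Module ℝ V]

/-- The Levi-Civita symbol becomes a polynomial in the indices: the product of their differences
vanishes on a repetition and otherwise is the sign times `12`, the Vandermonde determinant of `0, 1,
2, 3`. Index sums can then be evaluated by `simp` and `ring`. -/
lemma map_basis_eq_vandermonde (b : Module.Basis (Fin 4) ℝ V) (vol : V [⋀^Fin 4]→ₗ[ℝ] ℝ)
    (f : Fin 4 → Fin 4) :
    12 * vol (b ∘ f) = vol b * (Matrix.vandermonde (fun i ↦ (f i : ℝ))).det := by
  have h₁ : vol (b ∘ f) = vol b * b.det (b ∘ f) := by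
    conv_lhs => rw [vol.eq_smul_basis_det b]
    rfl
  have h₂ : (b.toMatrix (b ∘ f)).transpose * Matrix.vandermonde (fun i : Fin 4 ↦ (i : ℝ))
      = Matrix.vandermonde (fun i ↦ (f i : ℝ)) := by
    ext i j
    simp [Matrix.mul_apply, Module.Basis.toMatrix_apply, Matrix.vandermonde_apply,
      Finsupp.single_apply]
  have h₃ : (Matrix.vandermonde (fun i : Fin 4 ↦ ((i : ℕ) : ℝ))).det = 12 := by
    rw [Matrix.det_vandermonde]
    simp [Fin.prod_univ_succ, Fin.prod_Ioi_succ]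
    norm_num
  rw [h₁, ← h₂, Matrix.det_mul, h₃, Matrix.det_transpose, Module.Basis.det_apply]
  ring

end Dual

/-! ### The operator on two-forms attached to a symmetric matrix. -/

section CompoundEndomorphism

variable {V : Type*} [AddCommGroup V] [Module ℝ V]

lemma map_basis_four (b : Module.Basis (Fin 4) ℝ V) (vol : V [⋀^Fin 4]→ₗ[ℝ] ℝ)
    (i j k l : Fin 4) :
    vol ![b i, b j, b k, b l] = vol b * ((((j : ℕ) : ℝ) - (i : ℕ)) * (((k : ℕ) : ℝ) - (i : ℕ)) *
      (((l : ℕ) : ℝ) - (i : ℕ)) * (((k : ℕ) : ℝ) - (j : ℕ)) * (((l : ℕ) : ℝ) - (j : ℕ)) *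
      (((l : ℕ) : ℝ) - (k : ℕ)) / 12) := by
  have h := map_basis_eq_vandermonde b vol ![i, j, k, l]
  have hb : (b ∘ ![i, j, k, l]) = ![b i, b j, b k, b l] := by
    ext m; fin_cases m <;> rfl
  rw [hb, Matrix.det_vandermonde] at h
  simp [Fin.prod_univ_succ, Fin.prod_Ioi_succ] at h
  linear_combination h / 12

lemma sum_mul_map_basis (b : Module.Basis (Fin 4) ℝ V) (vol : V [⋀^Fin 4]→ₗ[ℝ] ℝ)
    {N : Matrix (Fin 4) (Fin 4) ℝ} (hN : N.transpose = -N) (k l : Fin 4) :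
    ∑ i, ∑ j, N i j * vol ![b i, b j, b k, b l] = 2 * vol b * dualMatrix N k l := by
  rw [eq_skewMatrix hN, dualMatrix_skewMatrix]
  simp only [map_basis_four]
  fin_cases k <;> fin_cases l <;> simp [Fin.sum_univ_four, skewMatrix] <;> ring

/-- The evaluation of two-forms on a pair of vectors. -/
def evalPair (v w : V) : (V [⋀^Fin 2]→ₗ[ℝ] ℝ) →ₗ[ℝ] ℝ where
  toFun α := α ![v, w]
  map_add' _ _ := rfl
  map_smul' _ _ := rfl

/-- The components of a two-form in a basis. -/
def twoFormMatrix (b : Module.Basis (Fin 4) ℝ V) (α : V [⋀^Fin 2]→ₗ[ℝ] ℝ) :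
    Matrix (Fin 4) (Fin 4) ℝ :=
  Matrix.of fun c d ↦ α ![b c, b d]

lemma transpose_twoFormMatrix (b : Module.Basis (Fin 4) ℝ V) (α : V [⋀^Fin 2]→ₗ[ℝ] ℝ) :
    (twoFormMatrix b α).transpose = -twoFormMatrix b α := by
  ext c d
  have h := α.map_swap ![b c, b d] (i := 0) (j := 1) (by decide)
  rw [Matrix.transpose_apply, Matrix.neg_apply, twoFormMatrix, Matrix.of_apply, Matrix.of_apply,
    ← h]
  congr 1
  ext m; fin_cases m <;> rfl

lemma twoFormMatrix_injective (b : Module.Basis (Fin 4) ℝ V) :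
    Function.Injective (twoFormMatrix b) := by
  intro α β h
  refine Module.Basis.ext_alternating b fun v _ ↦ ?_
  have h' : (fun i ↦ b (v i)) = ![b (v 0), b (v 1)] := by
    ext m; fin_cases m <;> rfl
  rw [h']
  exact congrFun (congrFun h (v 0)) (v 1)

/-- The endomorphism `α_{ab} ↦ ε_{ijab} K^{ic} K^{jd} α_{cd}` of two-forms. -/
def compoundEndomorphism (b : Module.Basis (Fin 4) ℝ V) (vol : V [⋀^Fin 4]→ₗ[ℝ] ℝ)
    (K : Matrix (Fin 4) (Fin 4) ℝ) : Module.End ℝ (V [⋀^Fin 2]→ₗ[ℝ] ℝ) :=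
  ∑ i, ∑ j, ∑ c, ∑ d, (K i c * K j d) •
    (evalPair (b c) (b d)).smulRight ((vol.curryLeft (b i)).curryLeft (b j))

lemma curryLeft_curryLeft_apply (vol : V [⋀^Fin 4]→ₗ[ℝ] ℝ) (u v w x : V) :
    (vol.curryLeft u).curryLeft v ![w, x] = vol ![u, v, w, x] := rfl

/-- This carries the operator over to skew matrices, where its square is known from
`dualMatrix_mul_dualMatrix_mul`. -/
lemma twoFormMatrix_compoundEndomorphism (b : Module.Basis (Fin 4) ℝ V)
    (vol : V [⋀^Fin 4]→ₗ[ℝ] ℝ) {K : Matrix (Fin 4) (Fin 4) ℝ} (hK : K.IsSymm)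
    (α : V [⋀^Fin 2]→ₗ[ℝ] ℝ) :
    twoFormMatrix b (compoundEndomorphism b vol K α) =
      (2 * vol b) • dualMatrix (K * twoFormMatrix b α * K) := by
  have hN : (K * twoFormMatrix b α * K).transpose = -(K * twoFormMatrix b α * K) := by
    simp [Matrix.transpose_mul, hK.eq, transpose_twoFormMatrix, mul_assoc]
  ext k l
  rw [Matrix.smul_apply, smul_eq_mul, ← sum_mul_map_basis b vol hN]
  change evalPair (b k) (b l) (compoundEndomorphism b vol K α) = _
  simp only [compoundEndomorphism, LinearMap.sum_apply, LinearMap.smul_apply,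
    LinearMap.smulRight_apply, map_sum, map_smul, smul_eq_mul, Matrix.mul_apply, Finset.sum_mul]
  refine Finset.sum_congr rfl fun i _ ↦ Finset.sum_congr rfl fun j _ ↦ ?_
  rw [Finset.sum_comm]
  refine Finset.sum_congr rfl fun c _ ↦ Finset.sum_congr rfl fun d _ ↦ ?_
  rw [hK.apply c j]
  simp only [evalPair, twoFormMatrix, LinearMap.coe_mk, AddHom.coe_mk, Matrix.of_apply,
    curryLeft_curryLeft_apply]
  ring

lemma dualMatrix_smul (c : ℝ) (N : Matrix (Fin 4) (Fin 4) ℝ) :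
    dualMatrix (c • N) = c • dualMatrix N := by
  simp [dualMatrix, smul_skewMatrix]

lemma compoundEndomorphism_mul_self (b : Module.Basis (Fin 4) ℝ V)
    (vol : V [⋀^Fin 4]→ₗ[ℝ] ℝ) {K : Matrix (Fin 4) (Fin 4) ℝ} (hK : K.IsSymm) :
    compoundEndomorphism b vol K * compoundEndomorphism b vol K =
      ((2 * vol b) ^ 2 * K.det) • 1 := by
  ext1 α
  apply twoFormMatrix_injective b
  rw [Module.End.mul_apply, twoFormMatrix_compoundEndomorphism b vol hK,
    twoFormMatrix_compoundEndomorphism b vol hK, Matrix.mul_smul, Matrix.smul_mul,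
    dualMatrix_smul, dualMatrix_mul_dualMatrix_mul hK (transpose_twoFormMatrix b α), smul_smul,
    smul_smul, ← pow_two]
  rfl

lemma trace_compoundEndomorphism (b : Module.Basis (Fin 4) ℝ V)
    (vol : V [⋀^Fin 4]→ₗ[ℝ] ℝ) {K : Matrix (Fin 4) (Fin 4) ℝ} (hK : K.IsSymm) :
    LinearMap.trace ℝ _ (compoundEndomorphism b vol K) = 0 := by
  have : FiniteDimensional ℝ V := b.finiteDimensional_of_finite
  -- The operator is a sum of rank-one maps `α ↦ α(b_c, b_d) ω`, each of trace `ω(b_c, b_d)`.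
  have h : LinearMap.trace ℝ _ (compoundEndomorphism b vol K) =
      ∑ i, ∑ j, ∑ c, ∑ d, K i c * K j d * vol ![b i, b j, b c, b d] := by
    simp only [compoundEndomorphism, map_sum, map_smul, LinearMap.trace_smulRight, smul_eq_mul]
    rfl
  have hswap (i j c d : Fin 4) : K i c * K j d * vol ![b i, b j, b c, b d] =
      -(K c i * K j d * vol ![b c, b j, b i, b d]) := by
    rw [map_basis_four, map_basis_four, hK.apply c i]
    ring
  -- Exchanging `i` and `c` fixes `K i c` and changes the sign of the volume form, so the sum equals
  -- its own negative.
  have h' : ∑ i, ∑ j, ∑ c, ∑ d, K i c * K j d * vol ![b i, b j, b c, b d] =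
      -∑ i, ∑ j, ∑ c, ∑ d, K i c * K j d * vol ![b i, b j, b c, b d] := by
    conv_lhs =>
      rw [Finset.sum_comm]
      enter [2, j]
      rw [Finset.sum_comm]
      enter [2, c, 2, i, 2, d]
      rw [hswap]
    simp only [Finset.sum_neg_distrib]
    rw [Finset.sum_comm]
  rw [h]
  linarith

/-- The trace identity for a curvature of the form `e₀ K₀ ∧ K₀ + e₁ K₁ ∧ K₁`. -/
lemma trace_sum_compoundEndomorphism_pow (b : Module.Basis (Fin 4) ℝ V)
    (vol : V [⋀^Fin 4]→ₗ[ℝ] ℝ) (K : Fin 2 → Matrix (Fin 4) (Fin 4) ℝ)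
    (hK : ∀ A, (K A).IsSymm) (e : Fin 2 → ℝ) {n : ℕ} (hn : Odd n) :
    LinearMap.trace ℝ _ ((∑ A, e A • compoundEndomorphism b vol (K A)) ^ n) = 0 := by
  have h (A : Fin 2) : (e A • compoundEndomorphism b vol (K A)) *
      (e A • compoundEndomorphism b vol (K A)) =
        (e A ^ 2 * ((2 * vol b) ^ 2 * (K A).det)) • 1 := by
    rw [smul_mul_smul_comm, compoundEndomorphism_mul_self b vol (hK A), smul_smul, pow_two (e A)]
  have ht (A : Fin 2) :
      LinearMap.trace ℝ _ (e A • compoundEndomorphism b vol (K A)) = 0 := by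
    rw [map_smul, trace_compoundEndomorphism b vol (hK A), smul_zero]
  rw [Fin.sum_univ_two]
  exact trace_add_pow_eq_zero_of_odd (h 0) (h 1) (ht 0) (ht 1) hn

end CompoundEndomorphism

/-! ### Calculus in coordinates. -/

section CoordinateDerivatives

variable {W : Type*} [NormedAddCommGroup W] [NormedSpace ℝ W] {V : Set E4} {x : E4}

/-- The coordinate derivative `∂_a u` of a vector-valued function. -/
def coordDeriv (a : Fin 4) (u : E4 → W) (x : E4) : W :=
  fderiv ℝ u x (EuclideanSpace.single a 1)

lemma contDiffOn_coordDeriv {u : E4 → W} (hV : IsOpen V) (hu : ContDiffOn ℝ ∞ u V) (a : Fin 4) :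
    ContDiffOn ℝ ∞ (coordDeriv a u) V :=
  (hu.fderiv_of_isOpen hV (by simp)).clm_apply contDiffOn_const

lemma differentiableAt_of_contDiffOn {u : E4 → W} (hV : IsOpen V) (hu : ContDiffOn ℝ ∞ u V)
    (hx : x ∈ V) : DifferentiableAt ℝ u x :=
  (hu.contDiffAt (hV.mem_nhds hx)).differentiableAt (by simp)

lemma coordDeriv_comm {u : E4 → W} (hV : IsOpen V) (hu : ContDiffOn ℝ ∞ u V) (hx : x ∈ V)
    (a b : Fin 4) : coordDeriv a (coordDeriv b u) x = coordDeriv b (coordDeriv a u) x := by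
  have hs : IsSymmSndFDerivAt ℝ u x :=
    (hu.contDiffAt (hV.mem_nhds hx)).isSymmSndFDerivAt
      (by simpa using (WithTop.coe_le_coe.2 le_top : ((2 : ℕ∞) : WithTop ℕ∞) ≤ ∞))
  have hd : DifferentiableAt ℝ (fderiv ℝ u) x :=
    differentiableAt_of_contDiffOn hV (hu.fderiv_of_isOpen hV (by simp)) hx
  have h (a b : Fin 4) : coordDeriv a (coordDeriv b u) x =
      fderiv ℝ (fderiv ℝ u) x (EuclideanSpace.single a 1) (EuclideanSpace.single b 1) := by
    unfold coordDeriv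
    rw [fderiv_clm_apply hd (differentiableAt_const _)]
    simp
  rw [h, h]
  exact hs _ _

lemma partialDeriv_bilinear (η : W →L[ℝ] W →L[ℝ] ℝ) {u v : E4 → W}
    (hu : DifferentiableAt ℝ u x) (hv : DifferentiableAt ℝ v x) (a : Fin 4) :
    partialDeriv a (fun y ↦ η (u y) (v y)) x =
      η (coordDeriv a u x) (v x) + η (u x) (coordDeriv a v x) := by
  rw [partialDeriv, η.fderiv_of_bilinear hu hv]
  simp [coordDeriv, add_comm]

lemma partialDeriv_congr {f₁ f₂ : E4 → ℝ} (hV : IsOpen V) (hx : x ∈ V)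
    (h : ∀ y ∈ V, f₁ y = f₂ y) (a : Fin 4) : partialDeriv a f₁ x = partialDeriv a f₂ x := by
  have : f₁ =ᶠ[𝓝 x] f₂ := Filter.eventuallyEq_of_mem (hV.mem_nhds hx) h
  rw [partialDeriv, this.fderiv_eq, partialDeriv]

lemma partialDeriv_sum_mul {ι : Type*} [Fintype ι] {f₁ f₂ : ι → E4 → ℝ}
    (h₁ : ∀ i, DifferentiableAt ℝ (f₁ i) x) (h₂ : ∀ i, DifferentiableAt ℝ (f₂ i) x) (a : Fin 4) :
    partialDeriv a (fun y ↦ ∑ i, f₁ i y * f₂ i y) x =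
      ∑ i, (partialDeriv a (f₁ i) x * f₂ i x + f₁ i x * partialDeriv a (f₂ i) x) := by
  unfold partialDeriv
  rw [fderiv_fun_sum fun i _ ↦ (h₁ i).fun_mul (h₂ i)]
  simp only [sum_apply]
  refine Finset.sum_congr rfl fun i _ ↦ ?_
  rw [fderiv_fun_mul (h₁ i) (h₂ i)]
  simp
  ring

lemma differentiableAt_det {n : ℕ} {G : E4 → Matrix (Fin n) (Fin n) ℝ}
    (hG : ∀ i j, DifferentiableAt ℝ (fun y ↦ G y i j) x) :
    DifferentiableAt ℝ (fun y ↦ (G y).det) x := by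
  simp only [Matrix.det_apply]
  refine DifferentiableAt.fun_sum fun σ _ ↦ ?_
  refine DifferentiableAt.const_smul ?_ _
  exact (HasFDerivAt.finsetProd fun i _ ↦ (hG (σ i) i).hasFDerivAt).differentiableAt

lemma differentiableAt_inv_apply {n : ℕ} {G : E4 → Matrix (Fin n) (Fin n) ℝ}
    (hG : ∀ i j, DifferentiableAt ℝ (fun y ↦ G y i j) x) (hdet : (G x).det ≠ 0) (i j : Fin n) :
    DifferentiableAt ℝ (fun y ↦ (G y)⁻¹ i j) x := by
  simp only [Matrix.inv_def, Matrix.smul_apply, Matrix.adjugate_apply, Ring.inverse_eq_inv',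
    smul_eq_mul]
  refine ((differentiableAt_det hG).inv hdet).mul (differentiableAt_det fun k l ↦ ?_)
  by_cases h : k = j
  · simp [Matrix.updateRow_apply, h]
  · simpa [Matrix.updateRow_apply, h] using hG k l

end CoordinateDerivatives

/-! ### Christoffel symbols and curvature of an induced metric. -/

section GaussEquation

variable {M : Type*} [TopologicalSpace M] [ChartedSpace E4 M] [IsManifold 𝓘(ℝ, E4) ∞ M]
  {g : PseudoRiemannianMetric M} {φ : OpenPartialHomeomorph M E4}
  {W : Type*} [NormedAddCommGroup W] [NormedSpace ℝ W] {η : W →L[ℝ] W →L[ℝ] ℝ}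
  {V : Set E4} {F : E4 → W} {x : E4}

lemma partialDeriv_metricMatrix (hV : IsOpen V) (hF : ContDiffOn ℝ ∞ F V)
    (hG : ∀ y ∈ V, ∀ i j, metricMatrix g φ y i j = η (coordDeriv i F y) (coordDeriv j F y))
    (hx : x ∈ V) (a i j : Fin 4) :
    partialDeriv a (fun y ↦ metricMatrix g φ y i j) x =
      η (coordDeriv a (coordDeriv i F) x) (coordDeriv j F x)
        + η (coordDeriv i F x) (coordDeriv a (coordDeriv j F) x) := by
  have hd (i) := differentiableAt_of_contDiffOn hV (contDiffOn_coordDeriv hV hF i) hx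
  rw [partialDeriv_congr hV hx fun y hy ↦ hG y hy i j, partialDeriv_bilinear η (hd i) (hd j)]

/-- The three metric derivatives give six terms. By symmetry of second derivatives four cancel and
the other two coincide, absorbing the factor `1 / 2`. -/
lemma christoffel_eq (hη : ∀ u v, η u v = η v u) (hV : IsOpen V) (hF : ContDiffOn ℝ ∞ F V)
    (hG : ∀ y ∈ V, ∀ i j, metricMatrix g φ y i j = η (coordDeriv i F y) (coordDeriv j F y))
    (hx : x ∈ V) (d b c : Fin 4) :
    christoffel g φ d b c x =
      ∑ e, (metricMatrix g φ x)⁻¹ d e * η (coordDeriv e F x) (coordDeriv b (coordDeriv c F) x) := by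
  rw [christoffel, Finset.mul_sum]
  refine Finset.sum_congr rfl fun e _ ↦ ?_
  simp only [partialDeriv_metricMatrix hV hF hG hx]
  rw [coordDeriv_comm hV hF hx e b, coordDeriv_comm hV hF hx e c, coordDeriv_comm hV hF hx c b,
    hη (coordDeriv c (coordDeriv e F) x)]
  ring

/-- Lowering the index removes the inverse metric, so this identity can be differentiated without a
formula for the derivative of `g⁻¹`. -/
lemma sum_metricMatrix_mul_christoffel (hη : ∀ u v, η u v = η v u) (hV : IsOpen V)
    (hF : ContDiffOn ℝ ∞ F V)
    (hG : ∀ y ∈ V, ∀ i j, metricMatrix g φ y i j = η (coordDeriv i F y) (coordDeriv j F y))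
    (hdet : ∀ y ∈ V, (metricMatrix g φ y).det ≠ 0)
    (hx : x ∈ V) (f b c : Fin 4) :
    ∑ d, metricMatrix g φ x f d * christoffel g φ d b c x =
      η (coordDeriv f F x) (coordDeriv b (coordDeriv c F) x) := by
  simp only [christoffel_eq hη hV hF hG hx]
  exact congrFun (Matrix.mulVec_mulVec
    (fun e ↦ η (coordDeriv e F x) (coordDeriv b (coordDeriv c F) x)) _ _ |>.trans
    (by rw [Matrix.mul_nonsing_inv _ (hdet x hx).isUnit, Matrix.one_mulVec])) f

lemma differentiableAt_metricMatrix (hV : IsOpen V) (hF : ContDiffOn ℝ ∞ F V)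
    (hG : ∀ y ∈ V, ∀ i j, metricMatrix g φ y i j = η (coordDeriv i F y) (coordDeriv j F y))
    (hx : x ∈ V) (i j : Fin 4) : DifferentiableAt ℝ (fun y ↦ metricMatrix g φ y i j) x := by
  have hd (i) := differentiableAt_of_contDiffOn hV (contDiffOn_coordDeriv hV hF i) hx
  have h := (η.hasFDerivAt_of_bilinear (hd i).hasFDerivAt (hd j).hasFDerivAt).differentiableAt
  exact h.congr_of_eventuallyEq
    (Filter.eventuallyEq_of_mem (hV.mem_nhds hx) fun y hy ↦ hG y hy i j)

lemma differentiableAt_christoffel (hη : ∀ u v, η u v = η v u) (hV : IsOpen V)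
    (hF : ContDiffOn ℝ ∞ F V)
    (hG : ∀ y ∈ V, ∀ i j, metricMatrix g φ y i j = η (coordDeriv i F y) (coordDeriv j F y))
    (hdet : ∀ y ∈ V, (metricMatrix g φ y).det ≠ 0)
    (hx : x ∈ V) (d b c : Fin 4) : DifferentiableAt ℝ (christoffel g φ d b c) x := by
  have hd (e) := differentiableAt_of_contDiffOn hV (contDiffOn_coordDeriv hV hF e) hx
  have hdd := differentiableAt_of_contDiffOn hV
    (contDiffOn_coordDeriv hV (contDiffOn_coordDeriv hV hF c) b) hx
  have h : DifferentiableAt ℝ (fun x ↦ ∑ e, (metricMatrix g φ x)⁻¹ d e *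
      η (coordDeriv e F x) (coordDeriv b (coordDeriv c F) x)) x :=
    DifferentiableAt.fun_sum fun e _ ↦
      (differentiableAt_inv_apply (differentiableAt_metricMatrix hV hF hG hx) (hdet x hx) d e).mul
        (η.hasFDerivAt_of_bilinear (hd e).hasFDerivAt hdd.hasFDerivAt).differentiableAt
  exact h.congr_of_eventuallyEq
    (Filter.eventuallyEq_of_mem (hV.mem_nhds hx) fun y hy ↦ christoffel_eq hη hV hF hG hy d b c)

/-- The part of `η` normal to the span of the vectors `t i`, whose Gram matrix has the
inverse `H`. -/
def normalForm (η : W →L[ℝ] W →L[ℝ] ℝ) (H : Matrix (Fin 4) (Fin 4) ℝ) (t : Fin 4 → W) :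
    LinearMap.BilinForm ℝ W :=
  LinearMap.mk₂ ℝ (fun u v ↦ η u v - ∑ d, ∑ e, H d e * (η (t d) u * η (t e) v))
    (fun u₁ u₂ v ↦ by simp [mul_add, add_mul, Finset.sum_add_distrib]; ring)
    (fun c u v ↦ by simp [Finset.mul_sum, mul_sub, mul_left_comm, mul_assoc])
    (fun u v₁ v₂ ↦ by simp [mul_add, Finset.sum_add_distrib]; ring)
    (fun c u v ↦ by simp [Finset.mul_sum, mul_sub, mul_left_comm])

lemma normalForm_apply (H : Matrix (Fin 4) (Fin 4) ℝ) (t : Fin 4 → W) (u v : W) :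
    normalForm η H t u v = η u v - ∑ d, ∑ e, H d e * (η (t d) u * η (t e) v) := rfl

lemma normalForm_isSymm (hη : ∀ u v, η u v = η v u) {H : Matrix (Fin 4) (Fin 4) ℝ}
    (hH : H.IsSymm) (t : Fin 4 → W) : (normalForm η H t).IsSymm := by
  refine ⟨fun u v ↦ ?_⟩
  rw [normalForm_apply, normalForm_apply, Finset.sum_comm, hη u v]
  congr 1
  refine Finset.sum_congr rfl fun e _ ↦ Finset.sum_congr rfl fun d _ ↦ ?_
  rw [hH.apply e d]
  ring

lemma normalForm_tangent {G : Matrix (Fin 4) (Fin 4) ℝ} (hdet : G.det ≠ 0) {t : Fin 4 → W}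
    (hG : ∀ i j, G i j = η (t i) (t j)) (hη : ∀ u v, η u v = η v u) (i : Fin 4) (w : W) :
    normalForm η G⁻¹ t (t i) w = 0 := by
  have h : ∀ e, ∑ d, η (t d) (t i) * G⁻¹ d e = (1 : Matrix (Fin 4) (Fin 4) ℝ) i e := by
    intro e
    rw [← Matrix.mul_nonsing_inv _ hdet.isUnit, Matrix.mul_apply]
    simp [hG, hη _ (t i)]
  rw [normalForm_apply, Finset.sum_comm]
  have : ∀ e, ∑ d, G⁻¹ d e * (η (t d) (t i) * η (t e) w) =
      (1 : Matrix (Fin 4) (Fin 4) ℝ) i e * η (t e) w := by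
    intro e
    rw [← h, Finset.sum_mul]
    exact Finset.sum_congr rfl fun d _ ↦ by ring
  simp [this, Matrix.one_apply]

/-- The Gauss equation, with the last index lowered. -/
lemma sum_metricMatrix_mul_riemann (hη : ∀ u v, η u v = η v u) (hV : IsOpen V)
    (hF : ContDiffOn ℝ ∞ F V)
    (hG : ∀ y ∈ V, ∀ i j, metricMatrix g φ y i j = η (coordDeriv i F y) (coordDeriv j F y))
    (hdet : ∀ y ∈ V, (metricMatrix g φ y).det ≠ 0)
    (hx : x ∈ V) (a b c f : Fin 4) :
    ∑ d, metricMatrix g φ x f d * riemann g φ a b c d x =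
      normalForm η (metricMatrix g φ x)⁻¹ (fun i ↦ coordDeriv i F x)
          (coordDeriv a (coordDeriv f F) x) (coordDeriv b (coordDeriv c F) x)
        - normalForm η (metricMatrix g φ x)⁻¹ (fun i ↦ coordDeriv i F x)
          (coordDeriv b (coordDeriv f F) x) (coordDeriv a (coordDeriv c F) x) := by
  have hd (i) := differentiableAt_of_contDiffOn hV (contDiffOn_coordDeriv hV hF i) hx
  have hdd (i j) := differentiableAt_of_contDiffOn hV
    (contDiffOn_coordDeriv hV (contDiffOn_coordDeriv hV hF i) j) hx
  have hderiv (a b c : Fin 4) :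
      ∑ d, metricMatrix g φ x f d * partialDeriv a (christoffel g φ d b c) x =
        η (coordDeriv a (coordDeriv f F) x) (coordDeriv b (coordDeriv c F) x)
          + η (coordDeriv f F x) (coordDeriv a (coordDeriv b (coordDeriv c F)) x)
          - ∑ d, (η (coordDeriv a (coordDeriv f F) x) (coordDeriv d F x)
            + η (coordDeriv f F x) (coordDeriv a (coordDeriv d F) x))
              * christoffel g φ d b c x := by
    have h₁ := partialDeriv_congr hV hx
      (fun y hy ↦ sum_metricMatrix_mul_christoffel hη hV hF hG hdet hy f b c) a
    rw [partialDeriv_bilinear η (hd f) (hdd c b), partialDeriv_sum_mul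
      (fun d ↦ differentiableAt_metricMatrix hV hF hG hx f d)
      (fun d ↦ differentiableAt_christoffel hη hV hF hG hdet hx d b c)] at h₁
    simp only [partialDeriv_metricMatrix hV hF hG hx, Finset.sum_add_distrib] at h₁
    exact eq_sub_of_add_eq' h₁
  -- These quadratic terms cancel the `η (∂_f F) (∂_a ∂_d F) Γ` terms of `hderiv`; what remains
  -- there of `Γ` is the tangential correction in `normalForm`.
  have hquad (a b c : Fin 4) :
      ∑ d, metricMatrix g φ x f d * ∑ e, christoffel g φ d a e x * christoffel g φ e b c x =
        ∑ e, η (coordDeriv f F x) (coordDeriv a (coordDeriv e F) x) * christoffel g φ e b c x := by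
    simp only [← sum_metricMatrix_mul_christoffel hη hV hF hG hdet hx, Finset.sum_mul,
      Finset.mul_sum]
    rw [Finset.sum_comm]
    exact Finset.sum_congr rfl fun d _ ↦ Finset.sum_congr rfl fun e _ ↦ by ring
  have hnormal (a b c : Fin 4) :
      ∑ d, η (coordDeriv a (coordDeriv f F) x) (coordDeriv d F x) * christoffel g φ d b c x =
        ∑ d, ∑ e, (metricMatrix g φ x)⁻¹ d e *
          (η (coordDeriv d F x) (coordDeriv a (coordDeriv f F) x) *
            η (coordDeriv e F x) (coordDeriv b (coordDeriv c F) x)) := by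
    simp only [christoffel_eq hη hV hF hG hx, Finset.mul_sum]
    refine Finset.sum_congr rfl fun d _ ↦ Finset.sum_congr rfl fun e _ ↦ ?_
    rw [hη _ (coordDeriv d F x)]
    ring
  have h₁ := hderiv a b c
  have h₂ := hderiv b a c
  simp only [add_mul, Finset.sum_add_distrib, hnormal] at h₁ h₂
  simp only [riemann, mul_add, mul_sub, Finset.sum_add_distrib, Finset.sum_sub_distrib, h₁, h₂,
    hquad, normalForm_apply]
  -- The third derivatives of `F` drop out of the antisymmetrisation in `a` and `b`.
  rw [coordDeriv_comm hV (contDiffOn_coordDeriv hV hF c) hx a b]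
  ring

end GaussEquation

/-! ### The ambient flat form. -/

section FlatMetric

/-- The flat metric as a continuous bilinear form. -/
def flatForm (r s : ℕ) : PseudoEuclidean r s →L[ℝ] PseudoEuclidean r s →L[ℝ] ℝ :=
  (LinearMap.mk₂ ℝ (flatMetric r s)
    (fun u₁ u₂ v ↦ by simp [flatMetric, add_mul, Finset.sum_add_distrib]; ring)
    (fun c u v ↦ by simp [flatMetric, mul_sub, Finset.mul_sum, mul_assoc])
    (fun u v₁ v₂ ↦ by simp [flatMetric, mul_add, Finset.sum_add_distrib]; ring)
    (fun c u v ↦ by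
      simp [flatMetric, mul_sub, Finset.mul_sum, mul_left_comm])).toContinuousBilinearMap

lemma flatForm_apply (r s : ℕ) (u v : PseudoEuclidean r s) :
    flatForm r s u v = flatMetric r s u v := rfl

lemma flatForm_comm (r s : ℕ) (u v : PseudoEuclidean r s) :
    flatForm r s u v = flatForm r s v u := by
  simp [flatForm_apply, flatMetric, mul_comm]

end FlatMetric

/-! ### Coordinate frames and the Gram matrix of a chart. -/

section Charts

variable {M : Type*} [TopologicalSpace M] [ChartedSpace E4 M] {φ : OpenPartialHomeomorph M E4}

lemma mdifferentiable_of_mem_maximalAtlas (hφ : φ ∈ IsManifold.maximalAtlas 𝓘(ℝ, E4) ∞ M) :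
    φ.MDifferentiable 𝓘(ℝ, E4) 𝓘(ℝ, E4) :=
  ⟨(contMDiffOn_of_mem_maximalAtlas hφ).mdifferentiableOn (by simp),
    (contMDiffOn_symm_of_mem_maximalAtlas hφ).mdifferentiableOn (by simp)⟩

lemma coordVector_eq (hφ : φ.MDifferentiable 𝓘(ℝ, E4) 𝓘(ℝ, E4)) {q : M} (hq : q ∈ φ.source)
    (i : Fin 4) : coordVector φ q i = (hφ.mfderiv hq).symm (EuclideanSpace.single i (1 : ℝ) : E4) :=
  congrFun (congrArg DFunLike.coe (ContinuousLinearMap.inverse_equiv (hφ.mfderiv hq)))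
    (EuclideanSpace.single i (1 : ℝ) : E4)

lemma coordVector_symm_eq (hφ : φ.MDifferentiable 𝓘(ℝ, E4) 𝓘(ℝ, E4)) {x : E4}
    (hx : x ∈ φ.target) (i : Fin 4) :
    coordVector φ (φ.symm x) i =
      mfderiv 𝓘(ℝ, E4) 𝓘(ℝ, E4) φ.symm x (EuclideanSpace.single i (1 : ℝ) : E4) := by
  -- The base point is generalised to `y` because the type of the differential depends on it, which
  -- blocks rewriting by `φ.right_inv`.
  have h (y : E4) (hy : φ (φ.symm x) = y) : (coordVector φ (φ.symm x) i : E4) =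
      (mfderiv 𝓘(ℝ, E4) 𝓘(ℝ, E4) φ.symm y (EuclideanSpace.single i (1 : ℝ) : E4) : E4) := by
    subst hy
    exact coordVector_eq hφ (φ.map_target hx) i
  exact h x (φ.right_inv hx)

/-- The coordinate frame of a chart as a basis of the tangent space. -/
def coordBasis (hφ : φ.MDifferentiable 𝓘(ℝ, E4) 𝓘(ℝ, E4)) {q : M} (hq : q ∈ φ.source) :
    Module.Basis (Fin 4) ℝ (TangentSpace 𝓘(ℝ, E4) q) :=
  (EuclideanSpace.basisFun (Fin 4) ℝ).toBasis.map (hφ.mfderiv hq).symm.toLinearEquiv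

lemma coordBasis_apply (hφ : φ.MDifferentiable 𝓘(ℝ, E4) 𝓘(ℝ, E4)) {q : M} (hq : q ∈ φ.source)
    (i : Fin 4) : coordBasis hφ hq i = coordVector φ q i := by
  rw [coordVector_eq hφ hq]
  refine congrArg (hφ.mfderiv hq).symm (?_ : (EuclideanSpace.basisFun (Fin 4) ℝ).toBasis i = _)
  rw [OrthonormalBasis.coe_toBasis, EuclideanSpace.basisFun_apply]

lemma det_metricMatrix_ne_zero [IsManifold 𝓘(ℝ, E4) ∞ M] (g : PseudoRiemannianMetric M)
    (hφ : φ.MDifferentiable 𝓘(ℝ, E4) 𝓘(ℝ, E4)) {x : E4} (hx : x ∈ φ.target) :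
    (metricMatrix g φ x).det ≠ 0 := by
  intro hdet
  obtain ⟨v, hv, hGv⟩ := Matrix.exists_vecMul_eq_zero_iff.2 hdet
  set b := coordBasis hφ (φ.map_target hx) with hb
  have hw : ∑ i, v i • b i = 0 := by
    refine g.nondegenerate _ _ fun w ↦ ?_
    rw [← b.sum_repr w, map_sum]
    refine Finset.sum_eq_zero fun j _ ↦ ?_
    have h := congrFun hGv j
    simp only [Matrix.vecMul, dotProduct, metricMatrix, Matrix.of_apply, Pi.zero_apply,
      ← coordBasis_apply hφ (φ.map_target hx)] at h
    rw [map_smul, map_sum, sum_apply]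
    simp only [map_smul, FunLike.coe_smul, Pi.smul_apply, smul_eq_mul]
    rw [h, mul_zero]
  exact hv (funext (Fintype.linearIndependent_iff.1 b.linearIndependent v hw))

lemma metricMatrix_isSymm [IsManifold 𝓘(ℝ, E4) ∞ M] (g : PseudoRiemannianMetric M) (x : E4) :
    (metricMatrix g φ x).IsSymm := by
  ext i j
  exact g.symm _ _ _

end Charts

/-! ### The Gauss equation in codimension two. -/

section EmbeddedChart

variable {M : Type*} [TopologicalSpace M] [ChartedSpace E4 M] [IsManifold 𝓘(ℝ, E4) ∞ M]
  {g : PseudoRiemannianMetric M} {φ : OpenPartialHomeomorph M E4} {r s : ℕ} {U : Set M}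
  {ι : M → PseudoEuclidean r s}

lemma contDiffOn_comp_chart_symm (hι : IsIsometricEmbeddingOn g r s U ι)
    (hφ : φ ∈ IsManifold.maximalAtlas 𝓘(ℝ, E4) ∞ M) :
    ContDiffOn ℝ ∞ (ι ∘ φ.symm) (φ.target ∩ φ.symm ⁻¹' U) :=
  contMDiffOn_iff_contDiffOn.1 <| hι.contMDiffOn.comp
    ((contMDiffOn_symm_of_mem_maximalAtlas hφ).mono Set.inter_subset_left)
    Set.inter_subset_right

lemma coordDeriv_comp_chart_symm (hι : IsIsometricEmbeddingOn g r s U ι)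
    (hφ : φ ∈ IsManifold.maximalAtlas 𝓘(ℝ, E4) ∞ M) {x : E4} (hx : x ∈ φ.target)
    (hxU : φ.symm x ∈ U) (i : Fin 4) :
    coordDeriv i (ι ∘ φ.symm) x =
      mfderiv 𝓘(ℝ, E4) 𝓘(ℝ, PseudoEuclidean r s) ι (φ.symm x)
        (coordVector φ (φ.symm x) i) := by
  have hd := mdifferentiable_of_mem_maximalAtlas hφ
  have hι' : MDifferentiableAt 𝓘(ℝ, E4) 𝓘(ℝ, PseudoEuclidean r s) ι (φ.symm x) :=
    (hι.contMDiffOn.contMDiffAt (hι.isOpen.mem_nhds hxU)).mdifferentiableAt (by simp)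
  rw [coordDeriv, ← mfderiv_eq_fderiv, mfderiv_comp x hι' (hd.mdifferentiableAt_symm hx),
    coordVector_symm_eq hd hx]
  rfl

lemma metricMatrix_eq_flatForm (hι : IsIsometricEmbeddingOn g r s U ι)
    (hφ : φ ∈ IsManifold.maximalAtlas 𝓘(ℝ, E4) ∞ M) {x : E4} (hx : x ∈ φ.target)
    (hxU : φ.symm x ∈ U) (i j : Fin 4) :
    metricMatrix g φ x i j =
      flatForm r s (coordDeriv i (ι ∘ φ.symm) x) (coordDeriv j (ι ∘ φ.symm) x) := by
  rw [coordDeriv_comp_chart_symm hι hφ hx hxU, coordDeriv_comp_chart_symm hι hφ hx hxU]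
  exact (hι.isometric _ hxU _ _).symm

lemma linearIndependent_coordDeriv (hι : IsIsometricEmbeddingOn g r s U ι)
    (hφ : φ ∈ IsManifold.maximalAtlas 𝓘(ℝ, E4) ∞ M) {x : E4} (hx : x ∈ φ.target)
    (hxU : φ.symm x ∈ U) :
    LinearIndependent ℝ fun i ↦ coordDeriv i (ι ∘ φ.symm) x := by
  have hd := mdifferentiable_of_mem_maximalAtlas hφ
  have h := (coordBasis hd (φ.map_target hx)).linearIndependent.map'
    (mfderiv 𝓘(ℝ, E4) 𝓘(ℝ, PseudoEuclidean r s) ι (φ.symm x)).toLinearMap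
    (LinearMap.ker_eq_bot.2 (hι.injective_mfderiv _ hxU))
  have h' : (fun i ↦ coordDeriv i (ι ∘ φ.symm) x) =
      mfderiv 𝓘(ℝ, E4) 𝓘(ℝ, PseudoEuclidean r s) ι (φ.symm x) ∘
        coordBasis hd (φ.map_target hx) := by
    funext i
    rw [coordDeriv_comp_chart_symm hι hφ hx hxU, Function.comp_apply, coordBasis_apply]
  rw [h']
  exact h

lemma sum_mul_mul_eq {n : Type*} [Fintype n] (P Q C D : n → ℝ) (X : Matrix n n ℝ) :
    ∑ a, ∑ b, ∑ k, ∑ f, P a * Q b * C k * D f * (X a f * X b k) =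
      (∑ a, ∑ f, P a * D f * X a f) * ∑ b, ∑ k, Q b * C k * X b k := by
  rw [Finset.sum_mul_sum]
  refine Finset.sum_congr rfl fun a _ ↦ Finset.sum_congr rfl fun b _ ↦ ?_
  rw [Finset.sum_mul_sum, Finset.sum_comm]
  exact Finset.sum_congr rfl fun k _ ↦ Finset.sum_congr rfl fun f _ ↦ by ring

/-- The Gauss equation in codimension two:
`R^{pqcd} = ∑_A e_A (K_A^{pd} K_A^{qc} - K_A^{qd} K_A^{pc})` for symmetric `K_A`, `A = 0, 1`. -/
lemma exists_riemannUp_eq (hrs : r + s = 6) (hι : IsIsometricEmbeddingOn g r s U ι)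
    (hφ : φ ∈ IsManifold.maximalAtlas 𝓘(ℝ, E4) ∞ M) {x : E4} (hx : x ∈ φ.target)
    (hxU : φ.symm x ∈ U) :
    ∃ (e : Fin 2 → ℝ) (K : Fin 2 → Matrix (Fin 4) (Fin 4) ℝ), (∀ A, (K A).IsSymm) ∧
      ∀ p q c d, riemannUp g φ p q c d x =
        ∑ A, e A * (K A p d * K A q c - K A q d * K A p c) := by
  set F := ι ∘ φ.symm with hFdef
  set V := φ.target ∩ φ.symm ⁻¹' U with hVdef
  set G := metricMatrix g φ x with hGdef
  have hd := mdifferentiable_of_mem_maximalAtlas hφ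
  have hV : IsOpen V := φ.isOpen_inter_preimage_symm hι.isOpen
  have hF : ContDiffOn ℝ ∞ F V := contDiffOn_comp_chart_symm hι hφ
  have hG : ∀ y ∈ V, ∀ i j, metricMatrix g φ y i j =
      flatForm r s (coordDeriv i F y) (coordDeriv j F y) :=
    fun y hy ↦ metricMatrix_eq_flatForm hι hφ hy.1 hy.2
  have hdet : ∀ y ∈ V, (metricMatrix g φ y).det ≠ 0 :=
    fun y hy ↦ det_metricMatrix_ne_zero g hd hy.1
  have hxV : x ∈ V := ⟨hx, hxU⟩
  have hGs : (G⁻¹).IsSymm := by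
    rw [Matrix.IsSymm, Matrix.transpose_nonsing_inv, (metricMatrix_isSymm g x).eq]
  set S := normalForm (flatForm r s) G⁻¹ (fun i ↦ coordDeriv i F x) with hS
  -- The four independent tangent vectors lie in the radical of `S`, and `r + s = 4 + 2`; this is
  -- where codimension two enters.
  obtain ⟨e, l, hel⟩ := exists_eq_sum_two_squares S
    (normalForm_isSymm (flatForm_comm r s) hGs _)
    (fun i ↦ coordDeriv i F x) (linearIndependent_coordDeriv hι hφ hx hxU)
    (by simp [hrs]) (normalForm_tangent (hdet x hxV) (hG x hxV) (flatForm_comm r s))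
  -- The `H A` play the role of second fundamental forms; raising both their indices gives the `K
  -- A`.
  let H (A : Fin 2) : Matrix (Fin 4) (Fin 4) ℝ :=
    Matrix.of fun a b ↦ l A (coordDeriv a (coordDeriv b F) x)
  have hH (A : Fin 2) : (H A).IsSymm := by
    ext a b
    exact congrArg (l A) (coordDeriv_comm hV hF hxV b a)
  have hK (A : Fin 2) (p q : Fin 4) :
      (G⁻¹ * H A * G⁻¹) p q = ∑ a, ∑ b, G⁻¹ p a * G⁻¹ q b * H A a b := by
    simp only [Matrix.mul_apply, Finset.sum_mul]
    rw [Finset.sum_comm]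
    refine Finset.sum_congr rfl fun a _ ↦ Finset.sum_congr rfl fun b _ ↦ ?_
    rw [hGs.apply q b]
    ring
  have hR (a b c d : Fin 4) : riemann g φ a b c d x =
      ∑ f, G⁻¹ d f * ∑ A, e A * (H A a f * H A b c - H A b f * H A a c) := by
    have h : G⁻¹.mulVec (G.mulVec fun k ↦ riemann g φ a b c k x) d = riemann g φ a b c d x := by
      rw [Matrix.mulVec_mulVec, Matrix.nonsing_inv_mul _ (hdet x hxV).isUnit, Matrix.one_mulVec]
    rw [← h]
    change ∑ f, G⁻¹ d f * ∑ k, G f k * riemann g φ a b c k x = _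
    refine Finset.sum_congr rfl fun f _ ↦ ?_
    congr 1
    have h₂ := sum_metricMatrix_mul_riemann (flatForm_comm r s) hV hF hG hdet hxV a b c f
    refine h₂.trans ?_
    rw [← hGdef, ← hS, hel, hel, ← Finset.sum_sub_distrib]
    refine Finset.sum_congr rfl fun A _ ↦ ?_
    simp only [H, Matrix.of_apply]
    ring
  refine ⟨e, fun A ↦ G⁻¹ * H A * G⁻¹, fun A ↦ ?_, fun p q c d ↦ ?_⟩
  · rw [Matrix.IsSymm, Matrix.transpose_mul, Matrix.transpose_mul, hGs.eq, (hH A).eq, ← mul_assoc]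
  · have h₁ (A : Fin 2) (p q : Fin 4) := sum_mul_mul_eq (G⁻¹ p) (G⁻¹ q) (G⁻¹ c) (G⁻¹ d) (H A)
    simp only [hK, ← h₁]
    rw [riemannUp]
    simp only [← hGdef, hR]
    -- Renaming `a` and `b` gives both Gauss terms the same prefactor, so they can be compared
    -- summand by summand.
    have h₂ (A : Fin 2) : ∑ a, ∑ b, ∑ k, ∑ f,
          G⁻¹ q a * G⁻¹ p b * G⁻¹ c k * G⁻¹ d f * (H A a f * H A b k) =
        ∑ a, ∑ b, ∑ k, ∑ f, G⁻¹ p a * G⁻¹ q b * G⁻¹ c k * G⁻¹ d f * (H A b f * H A a k) := by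
      rw [Finset.sum_comm]
      exact Finset.sum_congr rfl fun a _ ↦ Finset.sum_congr rfl fun b _ ↦
        Finset.sum_congr rfl fun k _ ↦ Finset.sum_congr rfl fun f _ ↦ by ring
    simp only [h₂, Fin.sum_univ_two (M := ℝ), mul_sub, Finset.mul_sum, ← Finset.sum_sub_distrib,
      ← Finset.sum_add_distrib]
    exact Finset.sum_congr rfl fun a _ ↦ Finset.sum_congr rfl fun b _ ↦
      Finset.sum_congr rfl fun k _ ↦ Finset.sum_congr rfl fun f _ ↦ by ring

end EmbeddedChart

/-! ### Decomposition of the curvature endomorphism. -/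

section CurvatureEndomorphism

variable {M : Type*} [TopologicalSpace M] [ChartedSpace E4 M] [IsManifold 𝓘(ℝ, E4) ∞ M]

/-- Against a skew `α`, the two terms of `K^{id} K^{jc} - K^{jd} K^{ic}` contribute equally, giving
`-2 K^{ic} K^{jd} α_{cd}`; the factor `-½` in `P` cancels the `-2`. -/
lemma curvatureEndomorphism_eq_sum (g : PseudoRiemannianMetric M) (q : M)
    (o : Orientation ℝ (TangentSpace 𝓘(ℝ, E4) q) (Fin 4)) {φ : OpenPartialHomeomorph M E4}
    (hφ : φ.MDifferentiable 𝓘(ℝ, E4) 𝓘(ℝ, E4)) (hq : q ∈ φ.source)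
    (e : Fin 2 → ℝ) (K : Fin 2 → Matrix (Fin 4) (Fin 4) ℝ)
    (hR : ∀ i j c d, riemannUp g φ i j c d (φ q) =
      ∑ A, e A * (K A i d * K A j c - K A j d * K A i c)) :
    curvatureEndomorphism g q o φ =
      ∑ A, e A • compoundEndomorphism (coordBasis hφ hq) (volumeForm g q o) (K A) := by
  set b := coordBasis hφ hq with hb
  ext1 α
  set N := twoFormMatrix b α with hN
  have hskew (c d) : N d c = -N c d := congrFun (congrFun (transpose_twoFormMatrix b α) c) d
  have hcoef (i j : Fin 4) : -(1 / 2) * ∑ c, ∑ d, riemannUp g φ i j c d (φ q) * N c d =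
      ∑ A, e A * ∑ c, ∑ d, K A i c * K A j d * N c d := by
    have hswap (A : Fin 2) : ∑ c, ∑ d, K A i d * K A j c * N c d =
        -∑ c, ∑ d, K A i c * K A j d * N c d := by
      rw [Finset.sum_comm]
      simp only [← Finset.sum_neg_distrib]
      refine Finset.sum_congr rfl fun c _ ↦ Finset.sum_congr rfl fun d _ ↦ ?_
      rw [hskew]
      ring
    have hsum : ∑ c, ∑ d, riemannUp g φ i j c d (φ q) * N c d =
        ∑ A, e A * (∑ c, ∑ d, K A i d * K A j c * N c d
          - ∑ c, ∑ d, K A i c * K A j d * N c d) := by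
      simp only [hR, Fin.sum_univ_two (M := ℝ), mul_sub, Finset.mul_sum,
        ← Finset.sum_sub_distrib, ← Finset.sum_add_distrib]
      exact Finset.sum_congr rfl fun c _ ↦ Finset.sum_congr rfl fun d _ ↦ by ring
    simp only [hsum, hswap, Fin.sum_univ_two (M := ℝ)]
    ring
  have hN' (c d : Fin 4) : evalPair (b c) (b d) α = N c d := rfl
  have hL : curvatureEndomorphism g q o φ α = ∑ i, ∑ j,
      (-(1 / 2) * ∑ c, ∑ d, riemannUp g φ i j c d (φ q) * N c d) •
        ((volumeForm g q o).curryLeft (b i)).curryLeft (b j) := by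
    change (-(1 / 2) : ℝ) • ∑ i, ∑ j, ∑ c, ∑ d,
      (riemannUp g φ i j c d (φ q) * α ![coordVector φ q c, coordVector φ q d]) •
      ((volumeForm g q o).curryLeft (coordVector φ q i)).curryLeft (coordVector φ q j) = _
    simp only [← coordBasis_apply hφ hq, ← hb, Finset.smul_sum, mul_smul, Finset.sum_smul]
    rfl
  rw [hL]
  simp only [hcoef, compoundEndomorphism, LinearMap.sum_apply, LinearMap.smul_apply,
    LinearMap.smulRight_apply, hN', Fin.sum_univ_two, Finset.smul_sum, Finset.sum_smul,
    Finset.mul_sum, smul_smul, add_smul, Finset.sum_add_distrib, mul_assoc, LinearMap.add_apply]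

end CurvatureEndomorphism

end FourManifold

end

theorem theorem2p1 {M : Type*} [TopologicalSpace M] [ChartedSpace FourManifold.E4 M]
    [IsManifold 𝓘(ℝ, FourManifold.E4) ∞ M]
    (g : FourManifold.PseudoRiemannianMetric M) (r s : ℕ) (hrs : r + s = 6)
    (U : Set M) (ι : M → FourManifold.PseudoEuclidean r s)
    (hι : FourManifold.IsIsometricEmbeddingOn g r s U ι)
    (q : M) (hq : q ∈ U)
    (o : Orientation ℝ (TangentSpace 𝓘(ℝ, FourManifold.E4) q) (Fin 4))
    (φ : OpenPartialHomeomorph M FourManifold.E4)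
    (hφ : φ ∈ IsManifold.maximalAtlas 𝓘(ℝ, FourManifold.E4) ∞ M) (hqφ : q ∈ φ.source) :
    LinearMap.trace ℝ _ (FourManifold.curvatureEndomorphism g q o φ ^ 3) = 0 ∧
    LinearMap.trace ℝ _ (FourManifold.curvatureEndomorphism g q o φ ^ 5) = 0 ∧
    ∀ n : ℕ, Odd n →
      LinearMap.trace ℝ _ (FourManifold.curvatureEndomorphism g q o φ ^ n) = 0 := by
  have hd := FourManifold.mdifferentiable_of_mem_maximalAtlas hφ
  obtain ⟨e, K, hK, hR⟩ := FourManifold.exists_riemannUp_eq hrs hι hφ (φ.map_source hqφ)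
    (by rwa [φ.left_inv hqφ])
  have h (n : ℕ) (hn : Odd n) :
      LinearMap.trace ℝ _ (FourManifold.curvatureEndomorphism g q o φ ^ n) = 0 := by
    rw [FourManifold.curvatureEndomorphism_eq_sum g q o hd hqφ e K hR]
    exact FourManifold.trace_sum_compoundEndomorphism_pow _ _ K hK e hn
  exact ⟨h 3 (by decide), h 5 (by decide), h⟩
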